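/- Let $M$ be a connected smooth surface (2-manifold), let $r:M\to\mathbb{E}^3$ be a smooth immersion into Euclidean 3-space with a smooth unit normal field $N$, and give $M$ the induced metric. Let $A$ be the shape operator, defined by $dN(X)=-dr(AX)$. Fix a unit vector $\vec k$, let $\theta=\angle(N,\vec k)$ be the angle function, and let $U$ be the tangent part of $\vec k$, so that $\vec k=U+\cos\theta\,N$. The surface is minimal if $\operatorname{trace}A=0$ everywhere. $U$ is a principal direction if at every point $U\neq 0$ (that is, $\theta\in(0,\pi)$) and $AU=\kappa U$ for some $\kappa\in\mathbb{R}$; it is a canonical principal direction if moreover $\kappa\ne 0$ at every point. (1) $M$ is minimal, $U$ is a principal direction and $\theta$ is not constant if and only if, up to an isometry of $\mathbb{E}^3$, the immersion is given in local coordinates by $$r(x,y)=\left(\sqrt{x^2+c^2}\cos y,\ \sqrt{x^2+c^2}\sin y,\ c\ln\big(x+\sqrt{x^2+c^2}\big)\right)$$ for some real $c\neq0$. Precisely: there are $c\neq 0$ and an isometry $\Phi$ of $\mathbb{E}^3$ whose linear part maps $(0,0,1)$ to $\vec k$ or $-\vec k$, such that every point of $M$ has a neighbourhood with smooth coordinates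 $(x,y)$ in which the immersion is $\Phi$ composed with the map above. (2) $M$ is minimal with $U$ a canonical principal direction if and only if $r(M)$ is contained in a catenoid with axis parallel to $\vec k$, that is, in $\Phi\big(\{(u,v,w): u^2+v^2=c^2\cosh^2(w/c)\}\big)$ for some $c>0$ and some isometry $\Phi$ of $\mathbb{E}^3$ whose linear part maps $(0,0,1)$ to $\pm\vec k$. -/

import Mathlib

open scoped Manifold ContDiff

noncomputable section

/-- Euclidean 3-space. -/
abbrev E3 : Type := EuclideanSpace ℝ (Fin 3)

/-- The differential at `p` of an `E3`-valued map on a surface, as a linear map `T_p M → E3`;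
that is, `X ↦ ∇̃_X f` for the flat connection of `E3`. -/
def ambientDeriv {M : Type*} [TopologicalSpace M] [ChartedSpace (EuclideanSpace ℝ (Fin 2)) M]
    (f : M → E3) (p : M) : TangentSpace (𝓡 2) p →ₗ[ℝ] E3 :=
  (mfderiv (𝓡 2) 𝓘(ℝ, E3) f p).toLinearMap

/-- A surface `M` (smooth 2-manifold without boundary) smoothly immersed in Euclidean 3-space,
with a smooth unit normal field. `M` carries the metric induced by the immersion. -/
structure ImmersedSurface (M : Type*) [TopologicalSpace M]
    [ChartedSpace (EuclideanSpace ℝ (Fin 2)) M] where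
  /-- the immersion -/
  r : M → E3
  r_smooth : ContMDiff (𝓡 2) 𝓘(ℝ, E3) ∞ r
  r_immersion : ∀ p, Function.Injective (ambientDeriv r p)
  /-- the unit normal field -/
  N : M → E3
  N_smooth : ContMDiff (𝓡 2) 𝓘(ℝ, E3) ∞ N
  N_unit : ∀ p, ‖N p‖ = 1
  N_normal : ∀ (p : M) (X : TangentSpace (𝓡 2) p), inner ℝ (ambientDeriv r p X) (N p) = 0

namespace ImmersedSurface

variable {M : Type*} [TopologicalSpace M] [ChartedSpace (EuclideanSpace ℝ (Fin 2)) M]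
  (S : ImmersedSurface M)

/-- The tangent part of an ambient vector at `p`: its orthogonal projection to the tangent plane
`dr (T_p M)`, read as an element of `T_p M`. -/
def tangentPart (p : M) : E3 →ₗ[ℝ] TangentSpace (𝓡 2) p :=
  (LinearEquiv.ofInjective (ambientDeriv S.r p) (S.r_immersion p)).symm.toLinearMap ∘ₗ
    ((LinearMap.range (ambientDeriv S.r p)).orthogonalProjectionOnto).toLinearMap

/-- The shape operator `A` at `p`, given by the Weingarten formula `∇̃_X N = - A X`. -/
def shapeOperator (p : M) : Module.End ℝ (TangentSpace (𝓡 2) p) :=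
  -(S.tangentPart p ∘ₗ ambientDeriv S.N p)

/-- The angle function `θ` between the unit normal and the fixed direction `k`. -/
def angle (k : E3) (p : M) : ℝ := InnerProductGeometry.angle (S.N p) k

/-- The tangent part `U` of the fixed direction `k`. -/
def U (k : E3) (p : M) : TangentSpace (𝓡 2) p := S.tangentPart p k

/-- The surface is minimal: the trace of the shape operator vanishes identically. -/
def IsMinimal : Prop := ∀ p, LinearMap.trace ℝ _ (S.shapeOperator p) = 0

/-- `U` is a principal direction everywhere: at each point it is an eigenvector (in particular
nonzero, which says that the angle lies strictly between `0` and `π`) of the shape operator. -/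
def IsPrincipalU (k : E3) : Prop :=
  ∀ p, ∃ κ : ℝ, (S.shapeOperator p).HasEigenvector κ (S.U k p)

/-- `U` is a canonical principal direction: it is a principal direction whose principal
curvature is nowhere zero. -/
def IsCanonicalPrincipalU (k : E3) : Prop :=
  ∀ p, ∃ κ : ℝ, κ ≠ 0 ∧ (S.shapeOperator p).HasEigenvector κ (S.U k p)

/-- The angle function is constant. -/
def HasConstantAngle (k : E3) : Prop := ∃ θ₀ : ℝ, ∀ p, S.angle k p = θ₀

end ImmersedSurface

/-- The parametrization
`(x, y) ↦ (√(x² + c²) cos y, √(x² + c²) sin y, c ln (x + √(x² + c²)))`. -/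
def catenoidParam (c x y : ℝ) : E3 :=
  !₂[√(x ^ 2 + c ^ 2) * Real.cos y, √(x ^ 2 + c ^ 2) * Real.sin y,
    c * Real.log (x + √(x ^ 2 + c ^ 2))]

/-- The catenoid: the catenary of radius `c cosh (z / c)` at height `z`, rotated about
the third axis. -/
def catenoid (c : ℝ) : Set E3 :=
  {v | v 0 ^ 2 + v 1 ^ 2 = (c * Real.cosh (v 2 / c)) ^ 2}

/-- The isometry `Φ` of Euclidean space carries the direction of the third axis to the
(unoriented) direction `k`. -/
def CarriesAxisTo (Φ : E3 ≃ᵃⁱ[ℝ] E3) (k : E3) : Prop :=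
  Φ.linearIsometryEquiv (EuclideanSpace.single 2 1) = k ∨
    Φ.linearIsometryEquiv (EuclideanSpace.single 2 1) = -k

end

/-! Write n = ⟨N, k⟩, so that |U|² = 1 - n². A self-adjoint traceless operator on a plane is
determined by one eigenvector and its eigenvalue: if AU = κU, then A is -κ on the orthogonal
complement of U. The Weingarten formula turns this into one first order equation, dN(X) = h [(1 -
n²) dr(X) - 2⟨dr(X), k⟩ (k - nN)] with h = κ / (1 - n²) (`ambientDeriv_N_eq`), and both directions
rest on it.

From the equation to the catenoid: let T be the inverse of the Gauss map of the catenoid with c = 1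
and axis k (`catenoidOfNormal`). The equation says exactly that d(T ∘ N) = h dr. Taking the exterior
derivative gives dh ∧ dr = 0, and since dr is injective on a plane, dh = 0. On a connected surface h
is therefore a constant a and T ∘ N = a r + b (`exists_eq_smul_add_of_ambientDeriv_eq_smul`). If a =
0, then N is constant and κ = 0, which either nonconstant angle or a canonical direction excludes.
Otherwise r = a⁻¹ (T ∘ N - b) lies on a catenoid of radius |a⁻¹|.

From the catenoid to the equation: the normal of the surface is, up to a constant sign ε, the
explicit normal of the catenoid (`exists_N_eq_catenoidNormal`), which satisfies the same equation
with h = ε / c (`hasDerivAt_catenoidNormal`). Minimality, the principal direction and the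
nonconstant angle are read off from it.

The local coordinates of (1) come from inverting the parametrization by sinh and a local branch of
the argument, with the inverse function theorem (`exists_openPartialHomeomorph_catenoidParam`). -/

section Calculus

/-! ### Calculus on a surface, in charts and along curves. -/

variable {M : Type*} [TopologicalSpace M] [ChartedSpace (EuclideanSpace ℝ (Fin 2)) M]

/-- A map on the surface read in the preferred chart at `p`. -/
def chartRead {F : Type*} (f : M → F) (p : M) : EuclideanSpace ℝ (Fin 2) → F :=
  f ∘ (chartAt (EuclideanSpace ℝ (Fin 2)) p).symm

theorem hasFDerivAt_chartRead {f : M → E3} {p : M} {D : EuclideanSpace ℝ (Fin 2) →L[ℝ] E3}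
    (h : HasMFDerivAt (𝓡 2) 𝓘(ℝ, E3) f p D) :
    HasFDerivAt (chartRead f p) D (chartAt (EuclideanSpace ℝ (Fin 2)) p p) := by
  have h2 : HasFDerivWithinAt (chartRead f p) D Set.univ
      (chartAt (EuclideanSpace ℝ (Fin 2)) p p) := by
    have := h.2
    simp only [mfld_simps] at this
    exact this
  exact hasFDerivWithinAt_univ.1 h2

/-- Every tangent vector is the velocity of a curve along which `E3`-valued maps may be
differentiated. -/
theorem exists_curve_hasDerivAt (p : M) (X : TangentSpace (𝓡 2) p) :
    ∃ γ : ℝ → M, γ 0 = p ∧ ∀ f : M → E3, MDifferentiableAt (𝓡 2) 𝓘(ℝ, E3) f p →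
      HasDerivAt (fun t => f (γ t)) (ambientDeriv f p X) 0 := by
  let X' : EuclideanSpace ℝ (Fin 2) := X
  let x₀ := chartAt (EuclideanSpace ℝ (Fin 2)) p p
  refine ⟨fun t => (chartAt (EuclideanSpace ℝ (Fin 2)) p).symm (x₀ + t • X'), by simp [x₀],
    fun f hf => ?_⟩
  have h2 : HasDerivAt (fun t : ℝ => x₀ + t • X') X' 0 := by
    simpa using ((hasDerivAt_id (0 : ℝ)).smul_const X').const_add x₀
  have h0 : x₀ = x₀ + (0 : ℝ) • X' := by simp
  have h1 := hasFDerivAt_chartRead hf.hasMFDerivAt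
  change HasFDerivAt _ _ x₀ at h1
  rw [h0] at h1
  exact HasFDerivAt.comp_hasDerivAt (x := (0 : ℝ)) (f := fun t : ℝ => x₀ + t • X') h1 h2

/-- The derivative at `p` on the surface is the derivative in the chart at `p`. -/
theorem ambientDeriv_eq_fderiv_chartRead {f : M → E3} {p : M}
    (hf : MDifferentiableAt (𝓡 2) 𝓘(ℝ, E3) f p) (X : EuclideanSpace ℝ (Fin 2)) :
    ambientDeriv f p X =
      fderiv ℝ (chartRead f p) (chartAt (EuclideanSpace ℝ (Fin 2)) p p) X := by
  rw [(hasFDerivAt_chartRead hf.hasMFDerivAt).fderiv]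
  rfl

/-- On a connected surface a map whose derivative vanishes in every chart is constant. -/
theorem exists_eq_const_of_fderiv_chartRead_eq_zero [ConnectedSpace M] {F : Type*}
    [NormedAddCommGroup F] [NormedSpace ℝ F] {f : M → F}
    (hf : ∀ p, ∀ x ∈ (chartAt (EuclideanSpace ℝ (Fin 2)) p).target,
      HasFDerivAt (chartRead f p) (0 : EuclideanSpace ℝ (Fin 2) →L[ℝ] F) x) :
    ∃ c, ∀ p, f p = c := by
  have hloc : IsLocallyConstant f := by
    rw [IsLocallyConstant.iff_eventually_eq]
    intro p
    set φ := chartAt (EuclideanSpace ℝ (Fin 2)) p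
    have hp : p ∈ φ.source := mem_chart_source _ p
    obtain ⟨ε, hε, hball⟩ := Metric.isOpen_iff.1 φ.open_target _ (φ.map_source hp)
    have hev : ∀ᶠ q in nhds p, φ q ∈ Metric.ball (φ p) ε :=
      (φ.continuousAt hp).eventually (Metric.ball_mem_nhds _ hε)
    filter_upwards [hev, φ.open_source.mem_nhds hp] with q hq hqs
    have := (convex_ball (φ p) ε).is_const_of_fderivWithin_eq_zero (𝕜 := ℝ)
      (f := chartRead f p) (fun x hx => (hf p x (hball hx)).differentiableAt.differentiableWithinAt)
      (fun x hx => by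
        rw [fderivWithin_of_isOpen Metric.isOpen_ball hx]
        exact (hf p x (hball hx)).fderiv)
      hq (Metric.mem_ball_self hε)
    simpa [chartRead, φ, φ.left_inv hqs, φ.left_inv hp] using this
  obtain ⟨p₀⟩ := (inferInstance : Nonempty M)
  exact ⟨f p₀, fun p => hloc.apply_eq_of_preconnectedSpace _ _⟩

variable [IsManifold (𝓡 2) ∞ M]

theorem contDiffOn_chartRead {f : M → E3} (hf : ContMDiff (𝓡 2) 𝓘(ℝ, E3) ∞ f) (p : M) :
    ContDiffOn ℝ ∞ (chartRead f p) (chartAt (EuclideanSpace ℝ (Fin 2)) p).target := by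
  rw [← contMDiffOn_iff_contDiffOn]
  exact hf.comp_contMDiffOn (contMDiffOn_chart_symm (I := 𝓡 2))

/-- The derivative in the chart is the derivative on the surface, precomposed with an injection
that does not depend on the map. -/
theorem exists_fderiv_chartRead_eq_ambientDeriv (p : M) {x : EuclideanSpace ℝ (Fin 2)}
    (hx : x ∈ (chartAt (EuclideanSpace ℝ (Fin 2)) p).target) :
    ∃ D : EuclideanSpace ℝ (Fin 2) →ₗ[ℝ]
        TangentSpace (𝓡 2) ((chartAt (EuclideanSpace ℝ (Fin 2)) p).symm x),
      Function.Injective D ∧ ∀ f : M → E3, ContMDiff (𝓡 2) 𝓘(ℝ, E3) ∞ f →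
        ∀ v, fderiv ℝ (chartRead f p) x v = ambientDeriv f _ (D v) := by
  have hmd := (mdifferentiable_chart (I := 𝓡 2) p).symm
  refine ⟨(mfderiv (𝓡 2) (𝓡 2) (chartAt (EuclideanSpace ℝ (Fin 2)) p).symm x).toLinearMap,
    hmd.mfderiv_injective hx, fun f hf v => ?_⟩
  have h1 := hmd.mdifferentiableAt hx
  have h2 := mfderiv_comp x (hf.mdifferentiable (by simp) _) h1
  rw [← mfderiv_eq_fderiv]
  exact congrArg (fun L => L v) h2

theorem injective_fderiv_chartRead {f : M → E3} (hf : ContMDiff (𝓡 2) 𝓘(ℝ, E3) ∞ f)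
    (hinj : ∀ p, Function.Injective (ambientDeriv f p)) (p : M) {x : EuclideanSpace ℝ (Fin 2)}
    (hx : x ∈ (chartAt (EuclideanSpace ℝ (Fin 2)) p).target) :
    Function.Injective (fderiv ℝ (chartRead f p) x) := by
  obtain ⟨D, hD, h⟩ := exists_fderiv_chartRead_eq_ambientDeriv p hx
  intro u v huv
  rw [h f hf, h f hf] at huv
  exact hD (hinj _ huv)

/-- If `dF = h dR` on an open set, where `R` is an immersion of a surface, then `dh = 0`. -/
theorem hasFDerivAt_zero_of_fderiv_eq_smul {F R : EuclideanSpace ℝ (Fin 2) → E3}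
    {h : EuclideanSpace ℝ (Fin 2) → ℝ} {s : Set (EuclideanSpace ℝ (Fin 2))} (hs : IsOpen s)
    (hF : ContDiffOn ℝ ∞ F s) (hR : ContDiffOn ℝ ∞ R s)
    (hinj : ∀ x ∈ s, Function.Injective (fderiv ℝ R x))
    (heq : ∀ x ∈ s, ∀ v, fderiv ℝ F x v = h x • fderiv ℝ R x v)
    {x : EuclideanSpace ℝ (Fin 2)} (hx : x ∈ s) :
    HasFDerivAt h (0 : EuclideanSpace ℝ (Fin 2) →L[ℝ] ℝ) x := by
  have hsx := hs.mem_nhds hx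
  have hF' := hF.contDiffAt hsx
  have hR' := hR.contDiffAt hsx
  have hdF : DifferentiableAt ℝ (fderiv ℝ F) x :=
    (hF'.fderiv_right (m := 1) (by norm_cast)).differentiableAt (by simp)
  have hdR : DifferentiableAt ℝ (fderiv ℝ R) x :=
    (hR'.fderiv_right (m := 1) (by norm_cast)).differentiableAt (by simp)
  -- No regularity of h is assumed; it is recovered as the quotient ⟨dF e, dR e⟩ / ⟨dR e, dR e⟩ for
  -- a fixed e ≠ 0.
  have hh : DifferentiableAt ℝ h x := by
    set e : EuclideanSpace ℝ (Fin 2) := EuclideanSpace.single 0 1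
    have he : e ≠ 0 := by simp [e]
    have hpos : ∀ y ∈ s, inner ℝ (fderiv ℝ R y e) (fderiv ℝ R y e) ≠ 0 := fun y hy h0 =>
      he (hinj y hy (by rw [inner_self_eq_zero.1 h0, map_zero]))
    have hFe : DifferentiableAt ℝ (fun y => fderiv ℝ F y e) x :=
      hdF.clm_apply (differentiableAt_const e)
    have hRe : DifferentiableAt ℝ (fun y => fderiv ℝ R y e) x :=
      hdR.clm_apply (differentiableAt_const e)
    have hnum := hFe.inner ℝ hRe
    have hden := hRe.inner ℝ hRe
    have hq := hnum.fun_mul (hden.fun_inv (hpos x hx))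
    refine hq.congr_of_eventuallyEq ?_
    filter_upwards [hsx] with y hy
    rw [heq y hy, real_inner_smul_left, mul_inv_cancel_right₀ (hpos y hy)]
  have hsymmF : IsSymmSndFDerivAt ℝ F x := hF'.isSymmSndFDerivAt (by simp; norm_cast)
  have hsymmR : IsSymmSndFDerivAt ℝ R x := hR'.isSymmSndFDerivAt (by simp; norm_cast)
  have hD : fderiv ℝ (fderiv ℝ F) x =
      h x • fderiv ℝ (fderiv ℝ R) x + (fderiv ℝ h x).smulRight (fderiv ℝ R x) := by
    rw [← (hh.hasFDerivAt.smul hdR.hasFDerivAt).fderiv]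
    refine Filter.EventuallyEq.fderiv_eq ?_
    filter_upwards [hsx] with y hy
    ext1 v
    simpa using heq y hy v
  -- Differentiate dF = h dR once more: the symmetric second derivatives of F and R cancel, leaving
  -- dh ∧ dR = 0.
  have key : ∀ u v, fderiv ℝ h x u • fderiv ℝ R x v = fderiv ℝ h x v • fderiv ℝ R x u := by
    intro u v
    have h1 := hsymmF u v
    have h2 := hsymmR u v
    rw [hD] at h1
    simpa [h2] using h1
  have hzero : fderiv ℝ h x = 0 := by
    have key2 : ∀ u v, fderiv ℝ h x u • v = fderiv ℝ h x v • u := fun u v =>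
      hinj x hx (by simpa using key u v)
    ext1 u
    -- Now dh(u) v = dh(v) u for all u, v. If u 0 = 0, the first coordinate with v = e₀ gives dh(u)
    -- = 0. Otherwise v = e₁ gives dh(e₁) = 0 in the first coordinate, and then dh(u) = 0 in the
    -- second.
    by_cases hu : u 0 = 0
    · have := congrArg (fun w : EuclideanSpace ℝ (Fin 2) => w 0)
        (key2 u (EuclideanSpace.single 0 1))
      simpa [hu] using this
    · have h1 := congrArg (fun w : EuclideanSpace ℝ (Fin 2) => w 0)
        (key2 u (EuclideanSpace.single 1 1))
      have h2 : fderiv ℝ h x (EuclideanSpace.single 1 1) = 0 := by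
        have : 0 = fderiv ℝ h x (EuclideanSpace.single 1 1) * u 0 := by simpa using h1
        exact (mul_eq_zero.1 this.symm).resolve_right hu
      have h3 := congrArg (fun w : EuclideanSpace ℝ (Fin 2) => w 1)
        (key2 u (EuclideanSpace.single 1 1))
      simpa [h2] using h3
  rw [← hzero]
  exact hh.hasFDerivAt

/-- If `dT = h dr` on a connected surface immersed by `r`, then `h` is a constant and `T - h r`
is a constant. -/
theorem exists_eq_smul_add_of_ambientDeriv_eq_smul [ConnectedSpace M] {T r : M → E3} {h : M → ℝ}
    (hT : ContMDiff (𝓡 2) 𝓘(ℝ, E3) ∞ T) (hr : ContMDiff (𝓡 2) 𝓘(ℝ, E3) ∞ r)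
    (hinj : ∀ p, Function.Injective (ambientDeriv r p))
    (heq : ∀ p X, ambientDeriv T p X = h p • ambientDeriv r p X) :
    ∃ (a : ℝ) (b : E3), ∀ p, h p = a ∧ T p = a • r p + b := by
  have hchart : ∀ p, ∀ x ∈ (chartAt (EuclideanSpace ℝ (Fin 2)) p).target, ∀ v,
      fderiv ℝ (chartRead T p) x v = chartRead h p x • fderiv ℝ (chartRead r p) x v := by
    intro p x hx v
    obtain ⟨D, -, hD⟩ := exists_fderiv_chartRead_eq_ambientDeriv p hx
    rw [hD T hT, hD r hr, heq]
    rfl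
  obtain ⟨a, ha⟩ := exists_eq_const_of_fderiv_chartRead_eq_zero (f := h) fun p x hx =>
    hasFDerivAt_zero_of_fderiv_eq_smul (chartAt (EuclideanSpace ℝ (Fin 2)) p).open_target
      (contDiffOn_chartRead hT p) (contDiffOn_chartRead hr p)
      (fun x hx => injective_fderiv_chartRead hr hinj p hx) (hchart p) hx
  obtain ⟨b, hb⟩ := exists_eq_const_of_fderiv_chartRead_eq_zero (f := fun q => T q - a • r q)
    fun p x hx => by
      have hs := (chartAt (EuclideanSpace ℝ (Fin 2)) p).open_target.mem_nhds hx
      have h1 := (((contDiffOn_chartRead hT p).contDiffAt hs).differentiableAt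
        (by simp)).hasFDerivAt
      have h2 := (((contDiffOn_chartRead hr p).contDiffAt hs).differentiableAt
        (by simp)).hasFDerivAt
      have h3 := h1.sub (h2.const_smul a)
      have h4 : fderiv ℝ (chartRead T p) x - a • fderiv ℝ (chartRead r p) x = 0 := by
        ext1 v
        have h5 : chartRead h p x = a := ha _
        simp [hchart p x hx v, h5]
      rw [h4] at h3
      exact h3
  exact ⟨a, b, fun p => ⟨ha p, by rw [← hb p]; abel⟩⟩

end Calculus

/-! ### Traceless self-adjoint operators on a plane. -/

section LinearAlgebra

variable {T E : Type*} [AddCommGroup T] [Module ℝ T] [NormedAddCommGroup E]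
  [InnerProductSpace ℝ E]

/-- A traceless endomorphism of a plane, self-adjoint for the inner product pulled back by an
injection `L`, is determined by one eigenvector. -/
theorem apply_eq_of_trace_eq_zero_of_hasEigenvector [FiniteDimensional ℝ T]
    (hT : Module.finrank ℝ T = 2) {L : T →ₗ[ℝ] E} (hL : Function.Injective L)
    {A : Module.End ℝ T} (hA : ∀ X Y, inner ℝ (L (A X)) (L Y) = inner ℝ (L X) (L (A Y)))
    (htr : LinearMap.trace ℝ T A = 0) {κ : ℝ} {U : T} (hU : A.HasEigenvector κ U) (X : T) :
    inner ℝ (L U) (L U) • A X =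
      κ • ((2 * inner ℝ (L X) (L U)) • U - inner ℝ (L U) (L U) • X) := by
  have hAU : A U = κ • U := hU.apply_eq_smul
  have hLU : inner ℝ (L U) (L U) ≠ 0 := fun h =>
    hU.2 (hL (by rw [inner_self_eq_zero.1 h, map_zero]))
  let f : T →ₗ[ℝ] ℝ := (innerₛₗ ℝ (L U)) ∘ₗ L
  -- A functional on a plane has a nonzero kernel, which supplies a vector V orthogonal to U.
  have hker : LinearMap.ker f ≠ ⊥ :=
    LinearMap.ker_ne_bot_of_finrank_lt (by rw [hT]; simp)
  obtain ⟨V, hV, hV0⟩ := (Submodule.ne_bot_iff _).1 hker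
  have hUV : inner ℝ (L U) (L V) = 0 := by simpa [f] using hV
  have hVU : inner ℝ (L V) (L U) = 0 := by rw [real_inner_comm]; exact hUV
  have hLV : inner ℝ (L V) (L V) ≠ 0 := fun h =>
    hV0 (hL (by rw [inner_self_eq_zero.1 h, map_zero]))
  have hli : LinearIndependent ℝ ![U, V] := by
    rw [LinearIndependent.pair_iff]
    intro s t hst
    have h1 := congrArg (fun w => inner ℝ (L w) (L U)) hst
    have h2 := congrArg (fun w => inner ℝ (L w) (L V)) hst
    simp only [map_add, map_smul, inner_add_left, real_inner_smul_left, hUV, hVU, map_zero,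
      inner_zero_left, mul_zero, add_zero, zero_add] at h1 h2
    exact ⟨(mul_eq_zero.1 h1).resolve_right hLU, (mul_eq_zero.1 h2).resolve_right hLV⟩
  let b : Module.Basis (Fin 2) ℝ T := basisOfLinearIndependentOfCardEqFinrank hli (by simp [hT])
  have hb0 : b 0 = U := by simp [b]
  have hb1 : b 1 = V := by simp [b]
  have hrepr : ∀ Y, Y = b.repr Y 0 • U + b.repr Y 1 • V := fun Y => by
    have h := b.sum_repr Y
    rw [Fin.sum_univ_two, hb0, hb1] at h
    exact h.symm
  -- Self-adjointness makes V an eigenvector too; the trace then forces its eigenvalue to be -κ.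
  have hAV0 : b.repr (A V) 0 = 0 := by
    have h1 := hA V U
    rw [hAU, map_smul, real_inner_smul_right, hVU, mul_zero, hrepr (A V)] at h1
    simp only [map_add, map_smul, inner_add_left, real_inner_smul_left, hVU, mul_zero,
      add_zero] at h1
    exact (mul_eq_zero.1 h1).resolve_right hLU
  have htr2 : κ + b.repr (A V) 1 = 0 := by
    rw [LinearMap.trace_eq_matrix_trace ℝ b, Matrix.trace_fin_two, LinearMap.toMatrix_apply,
      LinearMap.toMatrix_apply, hb0, hb1, hAU] at htr
    rw [← htr, ← hb0]
    simp
  have hAV : A V = -κ • V := by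
    rw [hrepr (A V), hAV0, zero_smul, zero_add, eq_neg_of_add_eq_zero_right htr2]
  rw [hrepr X]
  simp only [map_add, map_smul, hAU, hAV, inner_add_left, real_inner_smul_left, hVU]
  module

end LinearAlgebra

/-! ### Tangent plane, Weingarten formula and symmetry of the shape operator. -/

namespace ImmersedSurface

variable {M : Type*} [TopologicalSpace M] [ChartedSpace (EuclideanSpace ℝ (Fin 2)) M]
  (S : ImmersedSurface M)

instance finiteDimensional_tangentSpace (p : M) :
    FiniteDimensional ℝ (TangentSpace (𝓡 2) p) :=
  inferInstanceAs (FiniteDimensional ℝ (EuclideanSpace ℝ (Fin 2)))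

theorem finrank_tangentSpace (p : M) : Module.finrank ℝ (TangentSpace (𝓡 2) p) = 2 :=
  (finrank_euclideanSpace (𝕜 := ℝ) (ι := Fin 2)).trans (by simp)

theorem inner_N_self (p : M) : inner ℝ (S.N p) (S.N p) = 1 := by
  rw [real_inner_self_eq_norm_sq, S.N_unit, one_pow]

theorem N_ne_zero (p : M) : S.N p ≠ 0 := fun h => by simpa [h] using S.N_unit p

theorem range_ambientDeriv_r (p : M) :
    LinearMap.range (ambientDeriv S.r p) = (ℝ ∙ S.N p)ᗮ := by
  have hle : LinearMap.range (ambientDeriv S.r p) ≤ (ℝ ∙ S.N p)ᗮ := by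
    rintro _ ⟨X, rfl⟩
    rw [Submodule.mem_orthogonal_singleton_iff_inner_left]
    exact S.N_normal p X
  refine Submodule.eq_of_le_of_finrank_eq hle ?_
  have h1 := (ℝ ∙ S.N p).finrank_add_finrank_orthogonal
  rw [finrank_span_singleton (S.N_ne_zero p), finrank_euclideanSpace, Fintype.card_fin] at h1
  rw [LinearMap.finrank_range_of_inj (S.r_immersion p), finrank_tangentSpace]
  omega

theorem ambientDeriv_tangentPart (p : M) (v : E3) :
    ambientDeriv S.r p (S.tangentPart p v) = v - inner ℝ v (S.N p) • S.N p := by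
  have h1 : ambientDeriv S.r p (S.tangentPart p v) =
      (LinearMap.range (ambientDeriv S.r p)).starProjection v := by
    have := congrArg Subtype.val
      ((LinearEquiv.ofInjective (ambientDeriv S.r p) (S.r_immersion p)).apply_symm_apply
        ((LinearMap.range (ambientDeriv S.r p)).orthogonalProjectionOnto v))
    exact this
  rw [h1]
  refine (Submodule.eq_starProjection_of_mem_of_inner_eq_zero ?_ ?_)
  · rw [S.range_ambientDeriv_r, Submodule.mem_orthogonal_singleton_iff_inner_left, inner_sub_left,
      real_inner_smul_left, S.inner_N_self, mul_one, sub_self]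
  · rintro _ ⟨X, rfl⟩
    rw [sub_sub_cancel, real_inner_smul_left, real_inner_comm _ (S.N p), S.N_normal, mul_zero]

theorem ambientDeriv_U (k : E3) (p : M) :
    ambientDeriv S.r p (S.U k p) = k - inner ℝ (S.N p) k • S.N p := by
  rw [real_inner_comm]
  exact S.ambientDeriv_tangentPart p k

theorem inner_ambientDeriv_U (k : E3) (p : M) (X : TangentSpace (𝓡 2) p) :
    inner ℝ (ambientDeriv S.r p X) (ambientDeriv S.r p (S.U k p)) =
      inner ℝ (ambientDeriv S.r p X) k := by
  rw [S.ambientDeriv_U, inner_sub_right, real_inner_smul_right, S.N_normal, mul_zero, sub_zero]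

theorem inner_ambientDeriv_U_self {k : E3} (hk : ‖k‖ = 1) (p : M) :
    inner ℝ (ambientDeriv S.r p (S.U k p)) k = 1 - inner ℝ (S.N p) k ^ 2 := by
  rw [S.ambientDeriv_U, inner_sub_left, real_inner_smul_left, real_inner_self_eq_norm_sq, hk]
  ring

/-- The quantity 1 - n² is the squared length of U. -/
theorem one_sub_inner_sq_pos {k : E3} (hk : ‖k‖ = 1) {p : M} (hU : S.U k p ≠ 0) :
    0 < 1 - inner ℝ (S.N p) k ^ 2 := by
  rw [← S.inner_ambientDeriv_U_self hk, ← S.inner_ambientDeriv_U, real_inner_self_pos]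
  exact fun h => hU (S.r_immersion p (by rw [h, map_zero]))

theorem mdifferentiableAt_r (p : M) : MDifferentiableAt (𝓡 2) 𝓘(ℝ, E3) S.r p :=
  S.r_smooth.mdifferentiable (by simp) p

theorem mdifferentiableAt_N (p : M) : MDifferentiableAt (𝓡 2) 𝓘(ℝ, E3) S.N p :=
  S.N_smooth.mdifferentiable (by simp) p

theorem inner_ambientDeriv_N (p : M) (X : TangentSpace (𝓡 2) p) :
    inner ℝ (ambientDeriv S.N p X) (S.N p) = 0 := by
  obtain ⟨γ, rfl, hγ⟩ := exists_curve_hasDerivAt p X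
  have h1 := hγ _ (S.mdifferentiableAt_N _)
  have h2 := h1.inner ℝ h1
  have h3 : HasDerivAt (fun t => inner ℝ (S.N (γ t)) (S.N (γ t))) 0 0 := by
    simpa only [S.inner_N_self] using hasDerivAt_const (0 : ℝ) (1 : ℝ)
  have h4 := h2.unique h3
  rw [real_inner_comm] at h4
  linarith

/-- The Weingarten formula. -/
theorem ambientDeriv_shapeOperator (p : M) (X : TangentSpace (𝓡 2) p) :
    ambientDeriv S.r p (S.shapeOperator p X) = -ambientDeriv S.N p X := by
  have h := S.ambientDeriv_tangentPart p (ambientDeriv S.N p X)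
  rw [S.inner_ambientDeriv_N, zero_smul, sub_zero] at h
  rw [← h, ← map_neg]
  rfl

/-- The angle with `k` is constant if and only if `⟨N, k⟩` is. -/
theorem hasConstantAngle_iff {k : E3} (hk : ‖k‖ = 1) :
    S.HasConstantAngle k ↔ ∃ n₀ : ℝ, ∀ p, inner ℝ (S.N p) k = n₀ := by
  have hcos : ∀ p, Real.cos (S.angle k p) = inner ℝ (S.N p) k := fun p => by
    rw [angle, InnerProductGeometry.cos_angle, S.N_unit, hk]
    simp
  refine ⟨fun ⟨θ, h⟩ => ⟨Real.cos θ, fun p => by rw [← hcos, h]⟩,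
    fun ⟨n, h⟩ => ⟨Real.arccos n, fun p => ?_⟩⟩
  rw [angle, InnerProductGeometry.angle, h, S.N_unit, hk]
  simp

variable [IsManifold (𝓡 2) ∞ M]

/-- Differentiating ⟨dr(Y), N⟩ = 0 in a chart gives ⟨dr(Y), dN(X)⟩ = -⟨d²r(X, Y), N⟩, and d²r is
symmetric. -/
theorem inner_ambientDeriv_N_symm (p : M) (X Y : TangentSpace (𝓡 2) p) :
    inner ℝ (ambientDeriv S.N p X) (ambientDeriv S.r p Y) =
      inner ℝ (ambientDeriv S.r p X) (ambientDeriv S.N p Y) := by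
  let X' : EuclideanSpace ℝ (Fin 2) := X
  let Y' : EuclideanSpace ℝ (Fin 2) := Y
  set φ := chartAt (EuclideanSpace ℝ (Fin 2)) p
  have hs : φ.target ∈ nhds (φ p) :=
    φ.open_target.mem_nhds (φ.map_source (mem_chart_source _ p))
  have hR := (contDiffOn_chartRead S.r_smooth p).contDiffAt hs
  have hN := (contDiffOn_chartRead S.N_smooth p).contDiffAt hs
  have hdR : DifferentiableAt ℝ (fderiv ℝ (chartRead S.r p)) (φ p) :=
    (hR.fderiv_right (m := 1) (by norm_cast)).differentiableAt (by simp)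
  have hsymm : IsSymmSndFDerivAt ℝ (chartRead S.r p) (φ p) :=
    hR.isSymmSndFDerivAt (by simp; norm_cast)
  have key : ∀ u v : EuclideanSpace ℝ (Fin 2),
      inner ℝ (fderiv ℝ (chartRead S.r p) (φ p) v) (fderiv ℝ (chartRead S.N p) (φ p) u) +
        inner ℝ (fderiv ℝ (fderiv ℝ (chartRead S.r p)) (φ p) u v) (chartRead S.N p (φ p)) = 0 := by
    intro u v
    have h1 : HasFDerivAt (fun x => fderiv ℝ (chartRead S.r p) x v) _ (φ p) :=
      hdR.hasFDerivAt.clm_apply (hasFDerivAt_const v _)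
    have h2 := h1.inner ℝ (hN.differentiableAt (by simp)).hasFDerivAt
    have h3 : HasFDerivAt (fun x => inner ℝ (fderiv ℝ (chartRead S.r p) x v) (chartRead S.N p x))
        (0 : EuclideanSpace ℝ (Fin 2) →L[ℝ] ℝ) (φ p) := by
      refine (hasFDerivAt_const (0 : ℝ) (φ p)).congr_of_eventuallyEq ?_
      filter_upwards [hs] with x hx
      obtain ⟨D, -, hD⟩ := exists_fderiv_chartRead_eq_ambientDeriv p hx
      rw [hD S.r S.r_smooth]
      exact S.N_normal _ _
    have h4 := congrArg (fun L => L u) (h2.unique h3)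
    simpa using h4
  have e1 := key X' Y'
  have e2 := key Y' X'
  have e3 : ∀ Z : EuclideanSpace ℝ (Fin 2),
      ambientDeriv S.r p Z = fderiv ℝ (chartRead S.r p) (φ p) Z :=
    ambientDeriv_eq_fderiv_chartRead (S.mdifferentiableAt_r p)
  have e4 : ∀ Z : EuclideanSpace ℝ (Fin 2),
      ambientDeriv S.N p Z = fderiv ℝ (chartRead S.N p) (φ p) Z :=
    ambientDeriv_eq_fderiv_chartRead (S.mdifferentiableAt_N p)
  rw [hsymm X' Y'] at e1
  rw [real_inner_comm]
  change inner ℝ (ambientDeriv S.r p Y') (ambientDeriv S.N p X') =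
    inner ℝ (ambientDeriv S.r p X') (ambientDeriv S.N p Y')
  rw [e3, e3, e4, e4]
  linarith

theorem inner_shapeOperator_symm (p : M) (X Y : TangentSpace (𝓡 2) p) :
    inner ℝ (ambientDeriv S.r p (S.shapeOperator p X)) (ambientDeriv S.r p Y) =
      inner ℝ (ambientDeriv S.r p X) (ambientDeriv S.r p (S.shapeOperator p Y)) := by
  rw [S.ambientDeriv_shapeOperator, S.ambientDeriv_shapeOperator, inner_neg_left, inner_neg_right,
    S.inner_ambientDeriv_N_symm]

end ImmersedSurface

/-! ### The inverse Gauss map of the catenoid. -/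

/-- The point of the catenoid with axis `k` at which the unit normal is `v`. -/
noncomputable def catenoidOfNormal (k v : E3) : E3 :=
  (1 - inner ℝ v k ^ 2)⁻¹ • (v - inner ℝ v k • k) -
    ((Real.log (1 + inner ℝ v k) - Real.log (1 - inner ℝ v k)) / 2) • k

theorem contDiffAt_catenoidOfNormal (k : E3) {v : E3} (hv : 0 < 1 - inner ℝ v k ^ 2) :
    ContDiffAt ℝ ∞ (catenoidOfNormal k) v := by
  have h1 : 1 + inner ℝ v k ≠ 0 := by nlinarith
  have h2 : 1 - inner ℝ v k ≠ 0 := by nlinarith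
  have hn : ContDiffAt ℝ ∞ (fun w : E3 => inner ℝ w k) v := contDiffAt_id.inner ℝ contDiffAt_const
  have h3 := ((contDiffAt_const (c := (1 : ℝ))).sub (hn.pow 2)).inv hv.ne'
  have h4 := ((contDiffAt_const (c := (1 : ℝ))).add hn).log h1
  have h5 := ((contDiffAt_const (c := (1 : ℝ))).sub hn).log h2
  have h6 : ContDiffAt ℝ ∞ (fun _ : E3 => k) v := contDiffAt_const
  exact (h3.smul (contDiffAt_id.sub (hn.smul h6))).sub (((h4.sub h5).div_const 2).smul h6)

/-- Here r' plays the role of the velocity of the surface along a curve. The hypothesis on N' gives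
n' = -h (1 - n²) ⟨r', k⟩, and with it every term of the derivative except h r' cancels. -/
theorem hasDerivAt_catenoidOfNormal {k : E3} (hk : ‖k‖ = 1) {N : ℝ → E3} {N' r' : E3} {h t : ℝ}
    (hN : HasDerivAt N N' t) (hpos : 0 < 1 - inner ℝ (N t) k ^ 2)
    (hN' : N' = h • ((1 - inner ℝ (N t) k ^ 2) • r' -
      (2 * inner ℝ r' k) • (k - inner ℝ (N t) k • N t))) :
    HasDerivAt (fun s => catenoidOfNormal k (N s)) (h • r') t := by
  set n := inner ℝ (N t) k with hn
  have hkk : inner ℝ k k = 1 := by rw [real_inner_self_eq_norm_sq, hk, one_pow]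
  have h1 : 1 + n ≠ 0 := by nlinarith
  have h2 : 1 - n ≠ 0 := by nlinarith
  have hn' : inner ℝ N' k = -(h * (1 - n ^ 2) * inner ℝ r' k) := by
    rw [hN']
    simp only [inner_sub_left, real_inner_smul_left, hkk, ← hn]
    ring
  have dn : HasDerivAt (fun s => inner ℝ (N s) k) (inner ℝ N' k) t := by
    simpa using hN.inner ℝ (hasDerivAt_const t k)
  have d1 := (((dn.pow 2).const_sub 1).inv hpos.ne').smul (hN.sub (dn.smul_const k))
  have d2 := ((((dn.const_add 1).log h1).sub ((dn.const_sub 1).log h2)).div_const 2).smul_const k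
  refine (d1.sub d2).congr_deriv ?_
  simp only [Pi.sub_apply, Pi.pow_apply, Pi.inv_apply, ← hn, hn']
  rw [hN']
  have h3 : 1 - n ^ 2 ≠ 0 := hpos.ne'
  have h4 : 1 - n ^ 2 = (1 + n) * (1 - n) := by ring
  match_scalars
  all_goals (try rw [h4] at *); field_simp; try ring

/-- The argument of cosh is artanh n. For a unit vector v with ⟨v, k⟩ = n, the right side is the
squared distance of `catenoidOfNormal k v` from the axis, so this is the equation of the catenoid.
-/
theorem cosh_log_sub_log_half_sq {n : ℝ} (hn : 0 < 1 - n ^ 2) :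
    Real.cosh ((Real.log (1 + n) - Real.log (1 - n)) / 2) ^ 2 = (1 - n ^ 2)⁻¹ := by
  have h1 : 0 < 1 + n := by nlinarith
  have h2 : 0 < 1 - n := by nlinarith
  have h := Real.cosh_sq' ((Real.log (1 + n) - Real.log (1 - n)) / 2)
  have h' := Real.cosh_two_mul ((Real.log (1 + n) - Real.log (1 - n)) / 2)
  rw [mul_div_cancel₀ _ two_ne_zero] at h'
  have h4 := Real.cosh_log (x := (1 + n) / (1 - n)) (by positivity)
  rw [Real.log_div h1.ne' h2.ne'] at h4
  have h3 : Real.cosh ((Real.log (1 + n) - Real.log (1 - n)) / 2) ^ 2 =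
      (((1 + n) / (1 - n) + ((1 + n) / (1 - n))⁻¹) / 2 + 1) / 2 := by linarith
  rw [h3, show 1 - n ^ 2 = (1 + n) * (1 - n) by ring]
  field_simp
  ring

/-- A point lies on the catenoid moved by `Φ` if and only if its distance from the moved axis is
the catenary function of its height. -/
theorem mem_image_catenoid_iff (Φ : E3 ≃ᵃⁱ[ℝ] E3) (c : ℝ) (q : E3) :
    q ∈ Φ '' catenoid c ↔
      inner ℝ (q - Φ 0) (q - Φ 0) -
        inner ℝ (q - Φ 0) (Φ.linearIsometryEquiv (EuclideanSpace.single 2 1)) ^ 2 =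
      (c * Real.cosh (inner ℝ (q - Φ 0)
        (Φ.linearIsometryEquiv (EuclideanSpace.single 2 1)) / c)) ^ 2 := by
  obtain ⟨v, rfl⟩ := Φ.surjective q
  have h : Φ v - Φ 0 = Φ.linearIsometryEquiv v := by
    have := Φ.map_vsub v 0
    simpa using this.symm
  rw [Φ.injective.mem_set_image, h, LinearIsometryEquiv.inner_map_map,
    LinearIsometryEquiv.inner_map_map]
  have h2 : inner ℝ v v = v 0 ^ 2 + v 1 ^ 2 + v 2 ^ 2 := by
    rw [real_inner_self_eq_norm_sq, EuclideanSpace.real_norm_sq_eq, Fin.sum_univ_three]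
  have h3 : inner ℝ v (EuclideanSpace.single 2 1) = v 2 := by
    simp [PiLp.inner_apply]
  rw [h2, h3]
  simp [catenoid]

/-- There is an isometry that carries the origin to `b` and the third axis to `k`. -/
theorem exists_affineIsometryEquiv {k : E3} (hk : ‖k‖ = 1) (b : E3) :
    ∃ Φ : E3 ≃ᵃⁱ[ℝ] E3, Φ 0 = b ∧ Φ.linearIsometryEquiv (EuclideanSpace.single 2 1) = k := by
  let e : E3 := EuclideanSpace.single 2 1
  -- The reflection in the plane orthogonal to e - k exchanges the unit vectors e and k.
  let L : E3 ≃ₗᵢ[ℝ] E3 := (ℝ ∙ (e - k))ᗮ.reflection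
  have hL : L e = k := Submodule.reflection_sub (by simp [e, hk])
  refine ⟨L.toAffineIsometryEquiv.trans (AffineIsometryEquiv.constVAdd ℝ E3 b), by simp, ?_⟩
  exact hL

/-! ### Minimal surfaces with principal direction U lie on catenoids. -/

namespace ImmersedSurface

variable {M : Type*} [TopologicalSpace M] [ChartedSpace (EuclideanSpace ℝ (Fin 2)) M]
  [IsManifold (𝓡 2) ∞ M] (S : ImmersedSurface M)

/-- On a minimal surface with principal direction `U` the differential of the normal is determined
by the principal curvature. -/
theorem ambientDeriv_N_eq {k : E3} (hk : ‖k‖ = 1) {p : M} {κ : ℝ}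
    (hmin : LinearMap.trace ℝ _ (S.shapeOperator p) = 0)
    (hκ : (S.shapeOperator p).HasEigenvector κ (S.U k p)) (X : TangentSpace (𝓡 2) p) :
    ambientDeriv S.N p X = (κ / (1 - inner ℝ (S.N p) k ^ 2)) •
      ((1 - inner ℝ (S.N p) k ^ 2) • ambientDeriv S.r p X -
        (2 * inner ℝ (ambientDeriv S.r p X) k) • (k - inner ℝ (S.N p) k • S.N p)) := by
  have hpos := (S.one_sub_inner_sq_pos hk hκ.2).ne'
  have h := congrArg (ambientDeriv S.r p) (apply_eq_of_trace_eq_zero_of_hasEigenvector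
    (finrank_tangentSpace p) (S.r_immersion p) (S.inner_shapeOperator_symm p) hmin hκ X)
  simp only [map_smul, map_sub, S.inner_ambientDeriv_U, S.inner_ambientDeriv_U_self hk,
    S.ambientDeriv_shapeOperator] at h
  rw [S.ambientDeriv_U] at h
  rw [← smul_right_injective E3 hpos |>.eq_iff, ← neg_inj, ← smul_neg, h, smul_smul,
    mul_div_cancel₀ _ hpos]
  module

/-- A connected minimal surface with principal direction `U` lies on a catenoid, unless
its angle function is constant. -/
theorem exists_range_subset_catenoid [ConnectedSpace M] {k : E3} (hk : ‖k‖ = 1)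
    (hmin : S.IsMinimal) (hprin : S.IsPrincipalU k)
    (hne : ¬ S.HasConstantAngle k ∨ S.IsCanonicalPrincipalU k) :
    ∃ (c : ℝ) (Φ : E3 ≃ᵃⁱ[ℝ] E3), 0 < c ∧ CarriesAxisTo Φ k ∧
      Set.range S.r ⊆ Φ '' catenoid c := by
  -- The curvature is chosen pointwise, with no regularity; none is needed, since κ / (1 - n²) turns
  -- out to be constant.
  choose κ hκ using hprin
  have hpos : ∀ p, 0 < 1 - inner ℝ (S.N p) k ^ 2 := fun p => S.one_sub_inner_sq_pos hk (hκ p).2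
  have hder := fun p => S.ambientDeriv_N_eq hk (hmin p) (hκ p)
  have hT : ContMDiff (𝓡 2) 𝓘(ℝ, E3) ∞ (fun p => catenoidOfNormal k (S.N p)) := fun p =>
    (contDiffAt_catenoidOfNormal k (hpos p)).contMDiffAt.comp p (S.N_smooth p)
  obtain ⟨a, b, hab⟩ := exists_eq_smul_add_of_ambientDeriv_eq_smul hT S.r_smooth S.r_immersion
    (h := fun p => κ p / (1 - inner ℝ (S.N p) k ^ 2)) fun p X => by
      obtain ⟨γ, h0, hγ⟩ := exists_curve_hasDerivAt p X
      have h1 := hγ _ (hT.mdifferentiable (by simp) p)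
      have h2 := hγ _ (S.mdifferentiableAt_N p)
      exact h1.unique (hasDerivAt_catenoidOfNormal hk h2 (by rw [h0]; exact hpos p)
        (by rw [h0]; exact hder p X))
  -- If a = 0, then κ = 0 everywhere and dN = 0. The first alternative fails because N is constant,
  -- the second because κ is the eigenvalue of U.
  have ha : a ≠ 0 := by
    rintro rfl
    rcases hne with hne | hcan
    · refine hne ((S.hasConstantAngle_iff hk).2 ?_)
      obtain ⟨N₀, hN₀⟩ := exists_eq_const_of_fderiv_chartRead_eq_zero (f := S.N) fun p x hx => by
        have hs := (chartAt (EuclideanSpace ℝ (Fin 2)) p).open_target.mem_nhds hx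
        have h1 := (((contDiffOn_chartRead S.N_smooth p).contDiffAt hs).differentiableAt
          (by simp)).hasFDerivAt
        obtain ⟨D, -, hD⟩ := exists_fderiv_chartRead_eq_ambientDeriv p hx
        have h2 : fderiv ℝ (chartRead S.N p) x = 0 := by
          ext1 v
          rw [hD _ S.N_smooth, hder, (hab _).1, zero_smul]
          rfl
        rwa [h2] at h1
      exact ⟨inner ℝ N₀ k, fun p => by rw [hN₀]⟩
    · obtain ⟨p⟩ := (inferInstance : Nonempty M)
      obtain ⟨κ', h0, h1⟩ := hcan p
      have h2 : κ p • S.U k p = κ' • S.U k p :=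
        (hκ p).apply_eq_smul.symm.trans h1.apply_eq_smul
      have h3 : κ p = κ' := smul_left_injective ℝ h1.2 h2
      exact (div_ne_zero (h3 ▸ h0) (hpos p).ne') (hab p).1
  -- From T ∘ N = a r + b the centre is -a⁻¹ b and the scale is a⁻¹. Its sign may be dropped from
  -- the radius because cosh is even.
  obtain ⟨Φ, hΦ0, hΦk⟩ := exists_affineIsometryEquiv hk (-(a⁻¹ • b))
  refine ⟨|a⁻¹|, Φ, abs_pos.2 (inv_ne_zero ha), Or.inl hΦk, ?_⟩
  rintro _ ⟨p, rfl⟩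
  rw [mem_image_catenoid_iff, hΦk, hΦ0]
  have hr : S.r p - -(a⁻¹ • b) = a⁻¹ • catenoidOfNormal k (S.N p) := by
    rw [(hab p).2, smul_add, inv_smul_smul₀ ha]
    abel
  have hkk : inner ℝ k k = 1 := by rw [real_inner_self_eq_norm_sq, hk, one_pow]
  rw [hr]
  have hp := hpos p
  have hNN := S.inner_N_self p
  have hkN : inner ℝ k (S.N p) = inner ℝ (S.N p) k := real_inner_comm _ _
  have hch := cosh_log_sub_log_half_sq hp
  unfold catenoidOfNormal
  set n := inner ℝ (S.N p) k
  set Q := (Real.log (1 + n) - Real.log (1 - n)) / 2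
  have hz : inner ℝ (a⁻¹ • ((1 - n ^ 2)⁻¹ • (S.N p - n • k) - Q • k)) k = -(a⁻¹ * Q) := by
    simp only [real_inner_smul_left, inner_sub_left, hkk]
    ring
  have hcosh : Real.cosh (-(a⁻¹ * Q) / |a⁻¹|) = Real.cosh Q := by
    rw [← Real.cosh_abs, abs_div, abs_neg, abs_mul, abs_abs,
      mul_div_cancel_left₀ _ (abs_ne_zero.2 (inv_ne_zero ha)), Real.cosh_abs]
  rw [hz, hcosh, mul_pow, sq_abs, hch]
  simp only [real_inner_smul_left, real_inner_smul_right, inner_sub_left, inner_sub_right, hkk,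
    hNN, hkN]
  rw [show inner ℝ (S.N p) k = n from rfl]
  field_simp
  ring

end ImmersedSurface

/-! ### The Gauss map of the catenoid, and surfaces contained in a catenoid. -/

/-- The unit normal of the catenoid with axis `k` through the origin, at the point `v`. -/
noncomputable def catenoidNormal (c : ℝ) (k v : E3) : E3 :=
  (c * Real.cosh (inner ℝ v k / c) ^ 2)⁻¹ • (v - (inner ℝ v k +
    c * Real.cosh (inner ℝ v k / c) * Real.sinh (inner ℝ v k / c)) • k)

theorem inner_catenoidNormal {c : ℝ} (hc : c ≠ 0) {k : E3} (hk : ‖k‖ = 1) (v : E3) :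
    inner ℝ (catenoidNormal c k v) k =
      -(Real.sinh (inner ℝ v k / c) / Real.cosh (inner ℝ v k / c)) := by
  have hC := (Real.cosh_pos (inner ℝ v k / c)).ne'
  rw [catenoidNormal, real_inner_smul_left, inner_sub_left, real_inner_smul_left,
    real_inner_self_eq_norm_sq, hk]
  field_simp
  ring

theorem one_sub_inner_catenoidNormal_sq {c : ℝ} (hc : c ≠ 0) {k : E3} (hk : ‖k‖ = 1) (v : E3) :
    1 - inner ℝ (catenoidNormal c k v) k ^ 2 = (Real.cosh (inner ℝ v k / c) ^ 2)⁻¹ := by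
  have hC := (Real.cosh_pos (inner ℝ v k / c)).ne'
  rw [inner_catenoidNormal hc hk]
  field_simp
  linarith [Real.cosh_sq (inner ℝ v k / c)]

theorem inner_catenoidNormal_self {c : ℝ} (hc : c ≠ 0) {k : E3} (hk : ‖k‖ = 1) {v : E3}
    (hv : inner ℝ v v - inner ℝ v k ^ 2 = (c * Real.cosh (inner ℝ v k / c)) ^ 2) :
    inner ℝ (catenoidNormal c k v) (catenoidNormal c k v) = 1 := by
  have hC := (Real.cosh_pos (inner ℝ v k / c)).ne'
  have hkv : inner ℝ k v = inner ℝ v k := real_inner_comm _ _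
  have hkk : inner ℝ k k = 1 := by rw [real_inner_self_eq_norm_sq, hk, one_pow]
  have hs := Real.cosh_sq (inner ℝ v k / c)
  simp only [catenoidNormal, real_inner_smul_left, real_inner_smul_right, inner_sub_left,
    inner_sub_right, hkv, hkk]
  set z := inner ℝ v k
  set C := Real.cosh (z / c)
  set s := Real.sinh (z / c)
  have hv' : inner ℝ v v = z ^ 2 + (c * C) ^ 2 := by linarith
  rw [hv']
  field_simp
  linear_combination (-(c ^ 2 * C ^ 2)) * hs

/-- This is the equation of `ambientDeriv_N_eq` with h = 1 / c. It is an identity for the formula of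
the normal, valid along any differentiable curve in space and not only on the catenoid. -/
theorem hasDerivAt_catenoidNormal {c : ℝ} (hc : c ≠ 0) {k : E3} (hk : ‖k‖ = 1) {v : ℝ → E3}
    {v' : E3} {t : ℝ} (hv : HasDerivAt v v' t) :
    HasDerivAt (fun s => catenoidNormal c k (v s))
      (c⁻¹ • ((1 - inner ℝ (catenoidNormal c k (v t)) k ^ 2) • v' - (2 * inner ℝ v' k) •
        (k - inner ℝ (catenoidNormal c k (v t)) k • catenoidNormal c k (v t)))) t := by
  have hC := (Real.cosh_pos (inner ℝ (v t) k / c)).ne'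
  have hs := Real.cosh_sq (inner ℝ (v t) k / c)
  have dz : HasDerivAt (fun s => inner ℝ (v s) k) (inner ℝ v' k) t := by
    simpa using hv.inner ℝ (hasDerivAt_const t k)
  have dC := (dz.div_const c).cosh
  have dS := (dz.div_const c).sinh
  have d := (((dC.pow 2).const_mul c).inv (mul_ne_zero hc (pow_ne_zero 2 hC))).smul
    (hv.sub ((dz.add ((dC.const_mul c).mul dS)).smul_const k))
  refine d.congr_deriv ?_
  rw [one_sub_inner_catenoidNormal_sq hc hk, inner_catenoidNormal hc hk, catenoidNormal]
  simp only [Pi.sub_apply, Pi.pow_apply, Pi.inv_apply, Pi.mul_apply, Pi.add_apply]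
  set z := inner ℝ (v t) k
  set C := Real.cosh (z / c)
  set s := Real.sinh (z / c)
  match_scalars
  · field_simp
  · field_simp
    linear_combination (inner ℝ v' k * c * C ^ 2) * hs
  · field_simp
    ring

namespace ImmersedSurface

variable {M : Type*} [TopologicalSpace M] [ChartedSpace (EuclideanSpace ℝ (Fin 2)) M]
  (S : ImmersedSurface M)

/-- Since dr is injective, the equation for dN can be solved for A, which appears as a scalar plus a
rank one operator with image in the line of U. -/
theorem shapeOperator_eq_of_ambientDeriv_N_eq {k : E3} {p : M} {h : ℝ}
    (hN : ∀ X, ambientDeriv S.N p X = h • ((1 - inner ℝ (S.N p) k ^ 2) • ambientDeriv S.r p X -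
        (2 * inner ℝ (ambientDeriv S.r p X) k) • (k - inner ℝ (S.N p) k • S.N p)))
    (X : TangentSpace (𝓡 2) p) :
    S.shapeOperator p X = -(h * (1 - inner ℝ (S.N p) k ^ 2)) • X +
      (2 * h * inner ℝ (ambientDeriv S.r p X) k) • S.U k p := by
  apply S.r_immersion p
  rw [S.ambientDeriv_shapeOperator, hN, map_add, map_smul, map_smul, S.ambientDeriv_U]
  module

/-- The scalar part contributes -2h (1 - n²) in dimension two, and the rank one part 2h ⟨dr(U), k⟩ =
2h (1 - n²). -/
theorem trace_shapeOperator_eq_zero_of_ambientDeriv_N_eq {k : E3} (hk : ‖k‖ = 1) {p : M} {h : ℝ}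
    (hN : ∀ X, ambientDeriv S.N p X = h • ((1 - inner ℝ (S.N p) k ^ 2) • ambientDeriv S.r p X -
        (2 * inner ℝ (ambientDeriv S.r p X) k) • (k - inner ℝ (S.N p) k • S.N p))) :
    LinearMap.trace ℝ _ (S.shapeOperator p) = 0 := by
  let f : TangentSpace (𝓡 2) p →ₗ[ℝ] ℝ := (innerₛₗ ℝ k) ∘ₗ ambientDeriv S.r p
  have hA : S.shapeOperator p = -(h * (1 - inner ℝ (S.N p) k ^ 2)) • LinearMap.id +
      (2 * h) • f.smulRight (S.U k p) := by
    ext1 X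
    rw [S.shapeOperator_eq_of_ambientDeriv_N_eq hN]
    simp [f, smul_smul, real_inner_comm k]
  rw [hA, map_add, map_smul, map_smul, LinearMap.trace_id, LinearMap.trace_smulRight,
    finrank_tangentSpace]
  have hf : f (S.U k p) = 1 - inner ℝ (S.N p) k ^ 2 := by
    rw [← S.inner_ambientDeriv_U_self hk, real_inner_comm]
    rfl
  rw [hf]
  simp only [smul_eq_mul]
  push_cast
  ring

theorem hasEigenvector_of_ambientDeriv_N_eq {k : E3} (hk : ‖k‖ = 1) {p : M} {h : ℝ}
    (hpos : 0 < 1 - inner ℝ (S.N p) k ^ 2)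
    (hN : ∀ X, ambientDeriv S.N p X = h • ((1 - inner ℝ (S.N p) k ^ 2) • ambientDeriv S.r p X -
        (2 * inner ℝ (ambientDeriv S.r p X) k) • (k - inner ℝ (S.N p) k • S.N p))) :
    (S.shapeOperator p).HasEigenvector (h * (1 - inner ℝ (S.N p) k ^ 2)) (S.U k p) := by
  refine ⟨Module.End.mem_eigenspace_iff.2 ?_, fun h0 => ?_⟩
  · rw [S.shapeOperator_eq_of_ambientDeriv_N_eq hN, S.inner_ambientDeriv_U_self hk]
    module
  · rw [← S.inner_ambientDeriv_U_self hk, h0, map_zero, inner_zero_left] at hpos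
    exact hpos.false

/-- Where the normal varies like that of a catenoid, the angle function is not stationary. -/
theorem not_hasConstantAngle_of_ambientDeriv_N_eq {k : E3} (hk : ‖k‖ = 1) {p : M} {h : ℝ}
    (hh : h ≠ 0) (hpos : 0 < 1 - inner ℝ (S.N p) k ^ 2)
    (hN : ∀ X, ambientDeriv S.N p X = h • ((1 - inner ℝ (S.N p) k ^ 2) • ambientDeriv S.r p X -
        (2 * inner ℝ (ambientDeriv S.r p X) k) • (k - inner ℝ (S.N p) k • S.N p))) :
    ¬ S.HasConstantAngle k := by
  rw [S.hasConstantAngle_iff hk]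
  rintro ⟨n₀, hn₀⟩
  -- The derivative of n in the direction U is -h (1 - n²)², which is not zero.
  obtain ⟨γ, h0, hγ⟩ := exists_curve_hasDerivAt p (S.U k p)
  have h1 := (hγ _ (S.mdifferentiableAt_N p)).inner ℝ (hasDerivAt_const 0 k)
  simp only [hn₀] at h1
  have h2 := h1.unique (hasDerivAt_const (0 : ℝ) n₀)
  rw [inner_zero_right, zero_add, hN, S.inner_ambientDeriv_U_self hk, real_inner_smul_left,
    inner_sub_left, real_inner_smul_left, real_inner_smul_left, ← S.ambientDeriv_U,
    S.inner_ambientDeriv_U_self hk] at h2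
  set q := 1 - inner ℝ (S.N p) k ^ 2
  have h3 : h * q ^ 2 = 0 := by linear_combination -h2
  exact mul_ne_zero hh (pow_ne_zero 2 hpos.ne') h3

theorem hasConstantAngle_neg {k : E3} (h : S.HasConstantAngle k) : S.HasConstantAngle (-k) := by
  obtain ⟨θ, hθ⟩ := h
  exact ⟨Real.pi - θ, fun p => by
    rw [← hθ p, angle, angle, InnerProductGeometry.angle_neg_right]⟩

theorem isCanonicalPrincipalU_neg {k : E3} (h : S.IsCanonicalPrincipalU k) :
    S.IsCanonicalPrincipalU (-k) := by
  intro p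
  obtain ⟨κ, hκ, hU⟩ := h p
  have hneg : S.U (-k) p = -S.U k p := map_neg _ _
  refine ⟨κ, hκ, ?_⟩
  rw [hneg]
  exact ⟨neg_mem hU.1, neg_ne_zero.2 hU.2⟩

/-- The normal of a surface in a catenoid is, up to a constant sign, the normal of the catenoid. -/
theorem exists_N_eq_catenoidNormal [ConnectedSpace M] {k b : E3} (hk : ‖k‖ = 1) {c : ℝ}
    (hc : c ≠ 0)
    (hmem : ∀ p, inner ℝ (S.r p - b) (S.r p - b) - inner ℝ (S.r p - b) k ^ 2 =
      (c * Real.cosh (inner ℝ (S.r p - b) k / c)) ^ 2) :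
    ∃ ε : ℝ, ε ^ 2 = 1 ∧ ∀ p, S.N p = ε • catenoidNormal c k (S.r p - b) := by
  have horth : ∀ p X, inner ℝ (ambientDeriv S.r p X) (catenoidNormal c k (S.r p - b)) = 0 := by
    intro p X
    obtain ⟨γ, h0, hγ⟩ := exists_curve_hasDerivAt p X
    have hC := (Real.cosh_pos (inner ℝ (S.r p - b) k / c)).ne'
    have dv := (hγ _ (S.mdifferentiableAt_r p)).sub_const b
    have dz : HasDerivAt (fun s => inner ℝ (S.r (γ s) - b) k)
        (inner ℝ (ambientDeriv S.r p X) k) 0 := by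
      simpa using dv.inner ℝ (hasDerivAt_const 0 k)
    have d1 := (dv.inner ℝ dv).sub (dz.pow 2)
    have d2 := ((dz.div_const c).cosh.const_mul c).pow 2
    -- Differentiating the implicit equation of the catenoid: its gradient is a multiple of
    -- `catenoidNormal`.
    have heq := d1.unique (d2.congr_of_eventuallyEq (Filter.Eventually.of_forall
      fun s => hmem (γ s)))
    simp only [h0] at heq
    rw [catenoidNormal, real_inner_smul_right, inner_sub_right, real_inner_smul_right]
    rw [real_inner_comm (ambientDeriv S.r p X)] at heq
    set z' := inner ℝ (ambientDeriv S.r p X) k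
    set z := inner ℝ (S.r p - b) k
    refine mul_eq_zero_of_right _ ?_
    field_simp at heq
    norm_num at heq
    linear_combination heq / 2
  have hpar : ∀ p, catenoidNormal c k (S.r p - b) =
      inner ℝ (catenoidNormal c k (S.r p - b)) (S.N p) • S.N p := by
    intro p
    have e := S.ambientDeriv_tangentPart p (catenoidNormal c k (S.r p - b))
    set Y := S.tangentPart p (catenoidNormal c k (S.r p - b))
    -- The tangent part of the catenoid normal is orthogonal both to that normal and to N, hence to
    -- itself.
    have h0 : inner ℝ (ambientDeriv S.r p Y) (ambientDeriv S.r p Y) = 0 := by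
      nth_rewrite 2 [e]
      rw [inner_sub_right, real_inner_smul_right, horth, S.N_normal, mul_zero, sub_zero]
    rw [inner_self_eq_zero.1 h0] at e
    exact sub_eq_zero.1 e.symm
  have hsq : ∀ p, inner ℝ (catenoidNormal c k (S.r p - b)) (S.N p) ^ 2 = 1 := by
    intro p
    have h1 := inner_catenoidNormal_self hc hk (hmem p)
    rw [hpar p, real_inner_smul_left, real_inner_smul_right, S.inner_N_self, mul_one, ← sq] at h1
    exact h1
  have hcont : Continuous fun p => inner ℝ (catenoidNormal c k (S.r p - b)) (S.N p) := by
    have hv : Continuous fun p => S.r p - b := S.r_smooth.continuous.sub continuous_const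
    have hz : Continuous fun p => inner ℝ (S.r p - b) k := hv.inner continuous_const
    have hC := Real.continuous_cosh.comp (hz.div_const c)
    have hS := Real.continuous_sinh.comp (hz.div_const c)
    have hi := (continuous_const.mul (hC.pow 2)).inv₀ (fun p => mul_ne_zero hc
      (pow_ne_zero 2 (Real.cosh_pos (inner ℝ (S.r p - b) k / c)).ne'))
    exact (hi.smul (hv.sub ((hz.add ((continuous_const.mul hC).mul hS)).smul
      continuous_const))).inner S.N_smooth.continuous
  obtain ⟨ε, hε, hεp⟩ : ∃ ε : ℝ, ε ^ 2 = 1 ∧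
      ∀ p, inner ℝ (catenoidNormal c k (S.r p - b)) (S.N p) = ε := by
    -- A continuous function with square 1 on a connected space is constant.
    rcases isPreconnected_univ.eq_one_or_eq_neg_one_of_sq_eq hcont.continuousOn
      (fun p _ => hsq p) with h | h
    · exact ⟨1, by norm_num, fun p => h (Set.mem_univ p)⟩
    · exact ⟨-1, by norm_num, fun p => h (Set.mem_univ p)⟩
  refine ⟨ε, hε, fun p => ?_⟩
  rw [hpar p, hεp, smul_smul, ← sq, hε, one_smul]

/-- A surface in a catenoid is minimal, its canonical direction is principal with nonzero
curvature, and its angle function is not constant. -/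
theorem of_range_subset_catenoid [ConnectedSpace M] {k : E3} (hk : ‖k‖ = 1) {c : ℝ} (hc : 0 < c)
    {Φ : E3 ≃ᵃⁱ[ℝ] E3} (hΦ : CarriesAxisTo Φ k) (hmem : Set.range S.r ⊆ Φ '' catenoid c) :
    S.IsMinimal ∧ S.IsCanonicalPrincipalU k ∧ ¬ S.HasConstantAngle k := by
  have main : ∀ k' : E3, ‖k'‖ = 1 → Φ.linearIsometryEquiv (EuclideanSpace.single 2 1) = k' →
      S.IsMinimal ∧ S.IsCanonicalPrincipalU k' ∧ ¬ S.HasConstantAngle k' := by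
    intro k' hk' hΦk
    obtain ⟨ε, hε, hN⟩ := S.exists_N_eq_catenoidNormal (b := Φ 0) hk' hc.ne' fun p => by
      have := (mem_image_catenoid_iff Φ c (S.r p)).1 (hmem ⟨p, rfl⟩)
      rwa [hΦk] at this
    have hε0 : ε ≠ 0 := by
      rintro rfl
      norm_num at hε
    have hpos : ∀ p, 0 < 1 - inner ℝ (S.N p) k' ^ 2 := fun p => by
      rw [hN p, real_inner_smul_left, mul_pow, hε, one_mul,
        one_sub_inner_catenoidNormal_sq hc.ne' hk']
      have := Real.cosh_pos (inner ℝ (S.r p - Φ 0) k' / c)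
      positivity
    have hder : ∀ p X, ambientDeriv S.N p X = (ε * c⁻¹) • ((1 - inner ℝ (S.N p) k' ^ 2) •
        ambientDeriv S.r p X - (2 * inner ℝ (ambientDeriv S.r p X) k') •
          (k' - inner ℝ (S.N p) k' • S.N p)) := by
      intro p X
      obtain ⟨γ, h0, hγ⟩ := exists_curve_hasDerivAt p X
      have h1 := (hasDerivAt_catenoidNormal hc.ne' hk'
        ((hγ _ (S.mdifferentiableAt_r p)).sub_const (Φ 0))).const_smul ε
      have h2 := hγ _ (S.mdifferentiableAt_N p)
      have h3 := h2.unique (h1.congr_of_eventuallyEq (Filter.Eventually.of_forall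
        fun s => hN (γ s)))
      -- The bracket in the equation is even in the normal, so replacing the catenoid normal by ε
      -- times it only multiplies h by ε.
      rw [h3, h0, hN p, real_inner_smul_left, mul_pow, hε, one_mul, smul_smul ε,
        smul_smul (ε * _) ε, mul_right_comm, ← sq, hε, one_mul]
    have hh : ε * c⁻¹ ≠ 0 := mul_ne_zero hε0 (inv_ne_zero hc.ne')
    obtain ⟨p₀⟩ := (inferInstance : Nonempty M)
    exact ⟨fun p => S.trace_shapeOperator_eq_zero_of_ambientDeriv_N_eq hk' (hder p),
      fun p => ⟨_, mul_ne_zero hh (hpos p).ne',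
        S.hasEigenvector_of_ambientDeriv_N_eq hk' (hpos p) (hder p)⟩,
      S.not_hasConstantAngle_of_ambientDeriv_N_eq hk' hh (hpos p₀) (hder p₀)⟩
  rcases hΦ with h | h
  · exact main k hk h
  · obtain ⟨h1, h2, h3⟩ := main (-k) (by rwa [norm_neg]) h
    exact ⟨h1, by simpa using S.isCanonicalPrincipalU_neg h2,
      fun h4 => h3 (S.hasConstantAngle_neg h4)⟩

end ImmersedSurface

/-! ### The standard parametrization as local coordinates. -/

theorem AffineIsometryEquiv.contDiff_E3 (Φ : E3 ≃ᵃⁱ[ℝ] E3) : ContDiff ℝ ∞ Φ := by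
  have h : ⇑Φ = fun w => Φ.linearIsometryEquiv w + Φ 0 := by
    ext1 w
    have := Φ.map_vadd 0 w
    simpa using this
  rw [h]
  exact Φ.linearIsometryEquiv.contDiff.add contDiff_const

/-- An isometry may be precomposed with a translation along the third axis. -/
theorem exists_translate_axis (Φ : E3 ≃ᵃⁱ[ℝ] E3) (d : ℝ) :
    ∃ Ψ : E3 ≃ᵃⁱ[ℝ] E3, (∀ v, Ψ v = Φ (v + d • EuclideanSpace.single 2 1)) ∧
      ∀ k, CarriesAxisTo Φ k → CarriesAxisTo Ψ k := by
  refine ⟨(AffineIsometryEquiv.constVAdd ℝ E3 (d • EuclideanSpace.single 2 1)).trans Φ,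
    fun v => ?_, fun k h => h⟩
  simp [add_comm]

/-- With q = √(x² + c²), the numbers (x + q) / |c| and (q - x) / |c| are inverse to each other, so
cosh(log((x + q) / |c|)) = q / |c|. The translation by -c log |c| supplies the denominator in the
logarithm, and cosh being even absorbs the sign of c. -/
theorem catenoidParam_add_mem_catenoid {c : ℝ} (hc : c ≠ 0) (x y : ℝ) :
    catenoidParam c x y + (-(c * Real.log |c|)) • EuclideanSpace.single 2 1 ∈ catenoid |c| := by
  have hc' : 0 < |c| := abs_pos.2 hc
  have hc2 : 0 < c ^ 2 := by positivity
  have hsq : √(x ^ 2 + c ^ 2) ^ 2 = x ^ 2 + c ^ 2 := Real.sq_sqrt (by positivity)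
  have hpos : 0 < x + √(x ^ 2 + c ^ 2) := by
    have : |x| < √(x ^ 2 + c ^ 2) := by
      rw [← Real.sqrt_sq_eq_abs]
      exact Real.sqrt_lt_sqrt (sq_nonneg x) (by linarith)
    linarith [neg_abs_le x]
  set q := √(x ^ 2 + c ^ 2)
  have hcosh : Real.cosh ((c * Real.log (x + q) - c * Real.log |c|) / |c|) = q / |c| := by
    rw [← mul_sub, ← Real.log_div hpos.ne' hc'.ne', ← Real.cosh_abs, abs_div, abs_mul, abs_abs,
      mul_div_cancel_left₀ _ hc'.ne', Real.cosh_abs, Real.cosh_log (by positivity)]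
    field_simp
    rw [sq_abs]
    linear_combination -hsq
  set w := catenoidParam c x y + (-(c * Real.log |c|)) • EuclideanSpace.single 2 1
  have w0 : w 0 = q * Real.cos y := by simp [w, q, catenoidParam]
  have w1 : w 1 = q * Real.sin y := by simp [w, q, catenoidParam]
  have w2 : w 2 = c * Real.log (x + q) - c * Real.log |c| := by
    simp [w, q, catenoidParam, sub_eq_add_neg]
  change w 0 ^ 2 + w 1 ^ 2 = (|c| * Real.cosh (w 2 / |c|)) ^ 2
  rw [w0, w1, w2, hcosh, mul_div_cancel₀ _ hc'.ne', mul_pow, mul_pow, ← mul_add,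
    Real.cos_sq_add_sin_sq, mul_one]

/-- A surface given in local coordinates by the parametrization lies on a catenoid. -/
theorem exists_mem_image_catenoid_of_catenoidParam {c : ℝ} (hc : c ≠ 0) {Φ : E3 ≃ᵃⁱ[ℝ] E3}
    {k : E3} (hΦ : CarriesAxisTo Φ k) :
    ∃ Ψ : E3 ≃ᵃⁱ[ℝ] E3, CarriesAxisTo Ψ k ∧
      ∀ x y, Φ (catenoidParam c x y) ∈ Ψ '' catenoid |c| := by
  obtain ⟨Ψ, hΨ, hax⟩ := exists_translate_axis Φ (c * Real.log |c|)
  refine ⟨Ψ, hax k hΦ, fun x y => ⟨_, catenoidParam_add_mem_catenoid hc x y, ?_⟩⟩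
  rw [hΨ, neg_smul, neg_add_cancel_right]

/-- For x = c sinh(z / c) one has √(x² + c²) = c cosh(z / c), hence x + √(x² + c²) = c exp(z / c).
Its logarithm yields the height z up to the shift c log c. -/
theorem catenoidParam_eq_of_mem_catenoid {c : ℝ} (hc : 0 < c) {v : E3} (hv : v ∈ catenoid c)
    {y : ℝ} (hy0 : v 0 = √(v 0 ^ 2 + v 1 ^ 2) * Real.cos y)
    (hy1 : v 1 = √(v 0 ^ 2 + v 1 ^ 2) * Real.sin y) :
    catenoidParam c (c * Real.sinh (v 2 / c)) y =
      v + (c * Real.log c) • EuclideanSpace.single 2 1 := by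
  have hC := Real.cosh_pos (v 2 / c)
  have h1 : √(v 0 ^ 2 + v 1 ^ 2) = c * Real.cosh (v 2 / c) := by
    rw [show v 0 ^ 2 + v 1 ^ 2 = _ from hv, Real.sqrt_sq (by positivity)]
  have h2 : √((c * Real.sinh (v 2 / c)) ^ 2 + c ^ 2) = c * Real.cosh (v 2 / c) := by
    rw [show (c * Real.sinh (v 2 / c)) ^ 2 + c ^ 2 = (c * Real.cosh (v 2 / c)) ^ 2 by
      rw [mul_pow, mul_pow, Real.cosh_sq]; ring, Real.sqrt_sq (by positivity)]
  have h3 : c * Real.log (c * Real.sinh (v 2 / c) + c * Real.cosh (v 2 / c)) =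
      v 2 + c * Real.log c := by
    rw [← mul_add, Real.sinh_add_cosh, Real.log_mul hc.ne' (Real.exp_pos _).ne', Real.log_exp]
    field_simp
    ring
  rw [h1] at hy0 hy1
  ext i
  fin_cases i
  · simpa [catenoidParam, h2] using hy0.symm
  · simpa [catenoidParam, h2] using hy1.symm
  · simp [catenoidParam, h2, h3]

/-- The branch arg a + arg (b / a) of the argument of b is centred at a, so it is smooth in b near a
even if a lies on the cut of `Complex.arg`. -/
theorem norm_mul_cos_arg_add_arg_div {a b : ℂ} (ha : a ≠ 0) :
    b.re = ‖b‖ * Real.cos (a.arg + (b / a).arg) ∧ b.im = ‖b‖ * Real.sin (a.arg + (b / a).arg) := by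
  have h : b = (‖b‖ : ℂ) * Complex.exp ((a.arg + (b / a).arg : ℝ) * Complex.I) := by
    have h1 := Complex.norm_mul_exp_arg_mul_I a
    have h2 := Complex.norm_mul_exp_arg_mul_I (b / a)
    calc b = a * (b / a) := (mul_div_cancel₀ b ha).symm
      _ = (‖a‖ * Complex.exp (a.arg * Complex.I)) *
          (‖b / a‖ * Complex.exp ((b / a).arg * Complex.I)) := by rw [h1, h2]
      _ = _ := by
        have h3 : (‖a‖ : ℂ) ≠ 0 := by simpa using ha
        rw [norm_div]
        push_cast
        rw [add_mul, Complex.exp_add]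
        field_simp
  constructor
  · conv_lhs => rw [h]
    rw [Complex.re_ofReal_mul, Complex.exp_ofReal_mul_I_re]
  · conv_lhs => rw [h]
    rw [Complex.im_ofReal_mul, Complex.exp_ofReal_mul_I_im]

theorem differentiableAt_catenoidParam {c : ℝ} (hc : 0 < c) (w : EuclideanSpace ℝ (Fin 2)) :
    DifferentiableAt ℝ (fun w : EuclideanSpace ℝ (Fin 2) => catenoidParam c (w 0) (w 1)) w := by
  have hpos : 0 < w 0 ^ 2 + c ^ 2 := by positivity
  have hlt : 0 < w 0 + √(w 0 ^ 2 + c ^ 2) := by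
    have : |w 0| < √(w 0 ^ 2 + c ^ 2) := by
      rw [← Real.sqrt_sq_eq_abs]
      exact Real.sqrt_lt_sqrt (sq_nonneg _) (by nlinarith)
    linarith [neg_abs_le (w 0)]
  have d0 : DifferentiableAt ℝ (fun w : EuclideanSpace ℝ (Fin 2) => w 0) w := by fun_prop
  have d1 : DifferentiableAt ℝ (fun w : EuclideanSpace ℝ (Fin 2) => w 1) w := by fun_prop
  have dq := ((d0.pow 2).add_const (c ^ 2)).sqrt hpos.ne'
  rw [differentiableAt_euclidean]
  intro i
  fin_cases i
  · exact dq.mul d1.cos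
  · exact dq.mul d1.sin
  · exact ((d0.add dq).log hlt.ne').const_mul c

theorem exists_openPartialHomeomorph_of_injective_fderiv
    {F : EuclideanSpace ℝ (Fin 2) → EuclideanSpace ℝ (Fin 2)}
    {s : Set (EuclideanSpace ℝ (Fin 2))} (hs : IsOpen s) (hF : ContDiffOn ℝ ∞ F s)
    (hinj : ∀ x ∈ s, Function.Injective (fderiv ℝ F x)) {x₀ : EuclideanSpace ℝ (Fin 2)}
    (hx₀ : x₀ ∈ s) :
    ∃ e ∈ contDiffGroupoid ∞ (𝓡 2), x₀ ∈ e.source ∧ e.source ⊆ s ∧ ∀ x, e x = F x := by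
  have hat : ∀ x ∈ s, ContDiffAt ℝ ∞ F x := fun x hx => hF.contDiffAt (hs.mem_nhds hx)
  have heq : ∀ x ∈ s, ∃ A : EuclideanSpace ℝ (Fin 2) ≃L[ℝ] EuclideanSpace ℝ (Fin 2),
      HasFDerivAt F (A : EuclideanSpace ℝ (Fin 2) →L[ℝ] EuclideanSpace ℝ (Fin 2)) x := by
    intro x hx
    refine ⟨(LinearEquiv.ofInjectiveEndo (fderiv ℝ F x).toLinearMap
      (hinj x hx)).toContinuousLinearEquiv, ?_⟩
    exact ((hat x hx).differentiableAt (by simp)).hasFDerivAt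
  obtain ⟨A, hA⟩ := heq x₀ hx₀
  let e₀ := (hat x₀ hx₀).toOpenPartialHomeomorph F hA (by simp)
  -- Inside s the derivative is invertible at every point, so the inverse is smooth on the whole
  -- target and not only near the image of x₀.
  let e := e₀.restrOpen s hs
  have hsub : e.source ⊆ s := fun x hx => hx.2
  refine ⟨e, ?_, ⟨(hat x₀ hx₀).mem_toOpenPartialHomeomorph_source hA (by simp), hx₀⟩, hsub,
    fun x => rfl⟩
  rw [contDiffGroupoid, mem_groupoid_of_pregroupoid]
  have h1 : ContDiffOn ℝ ∞ e e.source := hF.mono hsub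
  have h2 : ContDiffOn ℝ ∞ e.symm e.target := fun y hy => by
    have hy' := hsub (e.map_target hy)
    obtain ⟨B, hB⟩ := heq _ hy'
    exact (e.contDiffAt_symm hy hB (hat _ hy')).contDiffWithinAt
  constructor
  · simpa [contDiffPregroupoid] using h1
  · simpa [contDiffPregroupoid] using h2

/-- An immersed piece of a catenoid may be reparametrized to the standard parametrization. -/
theorem exists_openPartialHomeomorph_catenoidParam {R : EuclideanSpace ℝ (Fin 2) → E3}
    {s : Set (EuclideanSpace ℝ (Fin 2))} (hs : IsOpen s) (hR : ContDiffOn ℝ ∞ R s)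
    (hinj : ∀ x ∈ s, Function.Injective (fderiv ℝ R x)) {c : ℝ} (hc : 0 < c)
    {Φ Ψ : E3 ≃ᵃⁱ[ℝ] E3} (hmem : ∀ x ∈ s, R x ∈ Φ '' catenoid c)
    (hΨ : ∀ v, Ψ (v + (c * Real.log c) • EuclideanSpace.single 2 1) = Φ v)
    {x₀ : EuclideanSpace ℝ (Fin 2)} (hx₀ : x₀ ∈ s) :
    ∃ e ∈ contDiffGroupoid ∞ (𝓡 2), x₀ ∈ e.source ∧ e.source ⊆ s ∧
      ∀ x ∈ e.source, R x = Ψ (catenoidParam c (e x 0) (e x 1)) := by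
  let v : EuclideanSpace ℝ (Fin 2) → E3 := fun x => Φ.symm (R x)
  have hv : ContDiffOn ℝ ∞ v s := Φ.symm.contDiff_E3.comp_contDiffOn hR
  have hvmem : ∀ x ∈ s, v x ∈ catenoid c := fun x hx => by
    obtain ⟨w, hw, hwx⟩ := hmem x hx
    simpa [v, ← hwx] using hw
  have hvi : ∀ i, ContDiffOn ℝ ∞ (fun x => v x i) s := fun i => contDiffOn_euclidean.1 hv i
  -- The component orthogonal to the axis as a complex number; its argument will be the coordinate
  -- y.
  let f : EuclideanSpace ℝ (Fin 2) → ℂ := fun x => (v x 0 : ℂ) + (v x 1 : ℂ) * Complex.I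
  have hf : ContDiffOn ℝ ∞ f s :=
    (Complex.ofRealCLM.contDiff.comp_contDiffOn (hvi 0)).add
      ((Complex.ofRealCLM.contDiff.comp_contDiffOn (hvi 1)).mul contDiffOn_const)
  have hre : ∀ x, (f x).re = v x 0 := fun x => by simp [f]
  have him : ∀ x, (f x).im = v x 1 := fun x => by simp [f]
  have hnorm : ∀ x, ‖f x‖ = √(v x 0 ^ 2 + v x 1 ^ 2) := fun x => Complex.norm_add_mul_I _ _
  have hf0 : f x₀ ≠ 0 := by
    rw [← norm_ne_zero_iff, hnorm, show v x₀ 0 ^ 2 + v x₀ 1 ^ 2 = _ from hvmem x₀ hx₀]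
    have := Real.cosh_pos (v x₀ 2 / c)
    positivity
  have hdiv : ContDiffOn ℝ ∞ (fun x => f x / f x₀) s := by
    simp only [div_eq_mul_inv]
    exact hf.mul contDiffOn_const
  let t := s ∩ (fun x => f x / f x₀) ⁻¹' Complex.slitPlane
  have ht : IsOpen t := hdiv.continuousOn.isOpen_inter_preimage hs Complex.isOpen_slitPlane
  have hts : t ⊆ s := Set.inter_subset_left
  have hx₀t : x₀ ∈ t := ⟨hx₀, by simp [div_self hf0]⟩
  let F : EuclideanSpace ℝ (Fin 2) → EuclideanSpace ℝ (Fin 2) := fun x =>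
    !₂[c * Real.sinh (v x 2 / c), (f x₀).arg + (f x / f x₀).arg]
  have hF : ContDiffOn ℝ ∞ F t := by
    rw [contDiffOn_euclidean]
    intro i
    fin_cases i
    · exact contDiffOn_const.mul (Real.contDiff_sinh.comp_contDiffOn
        (((hvi 2).mono hts).div_const c))
    · have hlog : ContDiffOn ℝ ∞ (fun x => Complex.log (f x / f x₀)) t := fun x hx =>
        ContDiffAt.comp_contDiffWithinAt (g := Complex.log) x
          ((Complex.contDiffAt_log hx.2).restrict_scalars ℝ) ((hdiv.mono hts) x hx)
      have him := Complex.imCLM.contDiff.comp_contDiffOn hlog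
      refine contDiffOn_const.add (him.congr fun x _ => ?_)
      simp [Complex.log_im]
  have hRF : ∀ x ∈ t, R x = Ψ (catenoidParam c (F x 0) (F x 1)) := by
    intro x hx
    obtain ⟨h0, h1⟩ := norm_mul_cos_arg_add_arg_div (b := f x) hf0
    rw [hre, hnorm] at h0
    rw [him, hnorm] at h1
    have h2 := catenoidParam_eq_of_mem_catenoid hc (hvmem x (hts hx)) h0 h1
    calc R x = Φ (v x) := by simp [v]
      _ = Ψ (catenoidParam c (c * Real.sinh (v x 2 / c)) ((f x₀).arg + (f x / f x₀).arg)) := by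
        rw [h2, hΨ]
      _ = _ := by simp [F]
  -- On t the immersion R factors through F, so by the chain rule the kernel of dF lies in that of
  -- dR.
  have hFinj : ∀ x ∈ t, Function.Injective (fderiv ℝ F x) := by
    intro x hx
    have hFx : DifferentiableAt ℝ F x :=
      (hF.contDiffAt (ht.mem_nhds hx)).differentiableAt (by simp)
    have hP : DifferentiableAt ℝ
        (fun w : EuclideanSpace ℝ (Fin 2) => Ψ (catenoidParam c (w 0) (w 1))) (F x) :=
      ((Ψ.contDiff_E3.differentiable (by simp)) _).comp _ (differentiableAt_catenoidParam hc _)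
    have hcomp := (hP.hasFDerivAt.comp x hFx.hasFDerivAt).congr_of_eventuallyEq (f₁ := R)
      (by filter_upwards [ht.mem_nhds hx] with y hy using hRF y hy)
    intro a b hab
    refine hinj x (hts hx) ?_
    rw [hcomp.fderiv]
    simp [hab]
  obtain ⟨e, he, hxe, hes, heF⟩ := exists_openPartialHomeomorph_of_injective_fderiv ht hF hFinj hx₀t
  exact ⟨e, he, hxe, hes.trans hts, fun x hx => by rw [heF]; exact hRF x (hes hx)⟩

theorem trans_mem_maximalAtlas {M : Type*} [TopologicalSpace M]
    [ChartedSpace (EuclideanSpace ℝ (Fin 2)) M] [IsManifold (𝓡 2) ∞ M] (p : M)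
    {e : OpenPartialHomeomorph (EuclideanSpace ℝ (Fin 2)) (EuclideanSpace ℝ (Fin 2))}
    (he : e ∈ contDiffGroupoid ∞ (𝓡 2)) :
    chartAt (EuclideanSpace ℝ (Fin 2)) p ≫ₕ e ∈ IsManifold.maximalAtlas (𝓡 2) ∞ M := by
  intro e' he'
  have hG : HasGroupoid M (contDiffGroupoid ∞ (𝓡 2)) := inferInstance
  constructor
  · rw [OpenPartialHomeomorph.trans_symm_eq_symm_trans_symm, OpenPartialHomeomorph.trans_assoc]
    exact (contDiffGroupoid ∞ (𝓡 2)).trans ((contDiffGroupoid ∞ (𝓡 2)).symm he)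
      (hG.compatible (chart_mem_atlas _ p) he')
  · rw [← OpenPartialHomeomorph.trans_assoc]
    exact (contDiffGroupoid ∞ (𝓡 2)).trans (hG.compatible he' (chart_mem_atlas _ p)) he

/-! ### The two characterizations. -/

theorem mainTheorem2 {M : Type*} [TopologicalSpace M] [ConnectedSpace M]
    [ChartedSpace (EuclideanSpace ℝ (Fin 2)) M] [IsManifold (𝓡 2) ∞ M]
    (S : ImmersedSurface M) (k : E3) (hk : ‖k‖ = 1) :
    ((S.IsMinimal ∧ S.IsPrincipalU k ∧ ¬ S.HasConstantAngle k) ↔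
      ∃ (c : ℝ) (Φ : E3 ≃ᵃⁱ[ℝ] E3), c ≠ 0 ∧ CarriesAxisTo Φ k ∧
        ∀ p : M, ∃ φ ∈ IsManifold.maximalAtlas (𝓡 2) ∞ M, p ∈ φ.source ∧
          ∀ q ∈ φ.source, S.r q = Φ (catenoidParam c (φ q 0) (φ q 1))) ∧
    ((S.IsMinimal ∧ S.IsCanonicalPrincipalU k) ↔
      ∃ (c : ℝ) (Φ : E3 ≃ᵃⁱ[ℝ] E3), 0 < c ∧ CarriesAxisTo Φ k ∧
        Set.range S.r ⊆ Φ '' catenoid c) := by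
  have hprin : S.IsCanonicalPrincipalU k → S.IsPrincipalU k := fun h p =>
    (h p).imp fun κ hκ => hκ.2
  refine ⟨⟨?_, ?_⟩, ⟨?_, ?_⟩⟩
  · rintro ⟨hmin, hpr, hne⟩
    obtain ⟨c, Φ, hc, hΦ, hsub⟩ := S.exists_range_subset_catenoid hk hmin hpr (Or.inl hne)
    -- The parametrized catenoid is the standard one raised by c log c, which this translation
    -- undoes.
    obtain ⟨Ψ, hΨ, hax⟩ := exists_translate_axis Φ (-(c * Real.log c))
    refine ⟨c, Ψ, hc.ne', hax k hΦ, fun p => ?_⟩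
    set ψ := chartAt (EuclideanSpace ℝ (Fin 2)) p
    have hp : p ∈ ψ.source := mem_chart_source _ p
    obtain ⟨e, he, hxe, -, heR⟩ := exists_openPartialHomeomorph_catenoidParam ψ.open_target
      (contDiffOn_chartRead S.r_smooth p)
      (fun x hx => injective_fderiv_chartRead S.r_smooth S.r_immersion p hx) hc
      (fun x _ => hsub ⟨_, rfl⟩) (fun v => by rw [hΨ, neg_smul, add_neg_cancel_right])
      (ψ.map_source hp)
    refine ⟨ψ ≫ₕ e, trans_mem_maximalAtlas p he, by simp [hp, hxe], fun q hq => ?_⟩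
    rw [OpenPartialHomeomorph.trans_source] at hq
    have h := heR _ hq.2
    rw [chartRead, Function.comp_apply, ψ.left_inv hq.1] at h
    exact h
  · rintro ⟨c, Φ, hc, hΦ, hloc⟩
    obtain ⟨Ψ, hΨ, hmem⟩ := exists_mem_image_catenoid_of_catenoidParam hc hΦ
    obtain ⟨h1, h2, h3⟩ := S.of_range_subset_catenoid hk (abs_pos.2 hc) hΨ (by
      rintro _ ⟨p, rfl⟩
      obtain ⟨φ, -, hp, h⟩ := hloc p
      rw [h p hp]
      exact hmem _ _)
    exact ⟨h1, hprin h2, h3⟩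
  · rintro ⟨hmin, hcan⟩
    exact S.exists_range_subset_catenoid hk hmin (hprin hcan) (Or.inr hcan)
  · rintro ⟨c, Φ, hc, hΦ, hsub⟩
    obtain ⟨h1, h2, -⟩ := S.of_range_subset_catenoid hk hc hΦ hsub
    exact ⟨h1, h2⟩
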